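/- Theorem. Let $d\ge 3$ be odd, let $\mathcal T=\mathcal T_d$ be the regular rooted tree in which every vertex has exactly $d$ descendants one level below it, and let $\operatorname{Aut}\mathcal T$ be the group of its automorphisms (the root-fixing graph automorphisms). Let $\operatorname{St}(1)$ be the subgroup of the automorphisms that fix all vertices of the first level. An element of $\operatorname{St}(1)$ acts on the $d$ subtrees hanging from the vertices of the first level, each of which is a copy of $\mathcal T$, and this identifies $\operatorname{St}(1)$ with $\operatorname{Aut}\mathcal T\times\overset{d}{\cdots}\times\operatorname{Aut}\mathcal T$. Define subgroups of $\operatorname{Aut}\mathcal T$ by $$M_0=\operatorname{Aut}\mathcal T,\qquad M_1=(\operatorname{Aut}\mathcal T)',\qquad M_2=(\operatorname{Aut}\mathcal T)'\cap\operatorname{St}(1),\qquad M_{k+2}=M_k\times\overset{d}{\cdots}\times M_k\le \operatorname{St}(1)\quad(k\ge 1).$$ Call a subgroup of a group $G$ fully invariant if every endomorphism of $G$ maps it into itself, and verbal if for some group word $w$ it is the subgroup generated by all values of $w$ in $G$. Then: 1. $M_0>M_1>M_2>\cdots$ is strictly decreasing; 2. every $M_k$ is a verbal subgroup of $\operatorname{Aut}\mathcal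 T$; 3. the fully invariant subgroups of $\operatorname{Aut}\mathcal T$ are exactly the trivial subgroup and the subgroups $M_k$, $k\ge 0$; 4. the verbal subgroups of $\operatorname{Aut}\mathcal T$ are likewise exactly the trivial subgroup and the subgroups $M_k$, $k\ge 0$. -/

import Mathlib

namespace RegularTree

/-- The `d`-adic rooted tree: its vertices are the finite words over `Fin d`, the root is the empty
word, and the `d` children of a word `u` are the words `u ++ [x]`, which are joined to `u`. -/
def tree (d : ℕ) : SimpleGraph (List (Fin d)) where
  Adj u v := (∃ x, v = u ++ [x]) ∨ (∃ x, u = v ++ [x])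
  symm := ⟨fun _ _ h => h.symm⟩
  loopless := ⟨fun u h => by
    rcases h with ⟨x, hx⟩ | ⟨x, hx⟩ <;> simpa using congrArg List.length hx⟩

/-- `Aut T_d`: the graph automorphisms of the tree that fix the root. -/
def autT (d : ℕ) : Subgroup (tree d ≃g tree d) where
  carrier := {g | g [] = []}
  mul_mem' {f g} hf hg := show f (g []) = [] by rw [hg, hf]
  one_mem' := rfl
  inv_mem' {g} hg := show g.symm [] = [] by
    rw [RelIso.symm_apply_eq]; exact Eq.symm hg

/-- The stabilizer `St(n)` of the `n`-th level. -/
def levelStab (d n : ℕ) : Subgroup (autT d) where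
  carrier := {g | ∀ u : List (Fin d), u.length = n → g.1 u = u}
  mul_mem' {f g} hf hg u hu := show f.1 (g.1 u) = u by rw [hg u hu, hf u hu]
  one_mem' _ _ := rfl
  inv_mem' {g} hg u hu := show g.1.symm u = u by
    rw [RelIso.symm_apply_eq]; exact (hg u hu).symm

/-- The map underlying `(h_1, …, h_d)`: it fixes the first letter `x` of a word and acts as `h_x` on
the rest of the word. -/
def prodFun {d : ℕ} (h : Fin d → autT d) : List (Fin d) → List (Fin d)
  | [] => []
  | x :: v => x :: (h x).1 v

theorem prodFun_adj {d : ℕ} (h : Fin d → autT d) {u v : List (Fin d)} (huv : (tree d).Adj u v) :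
    (tree d).Adj (prodFun h u) (prodFun h v) := by
  have key : ∀ (u : List (Fin d)) (x : Fin d),
      (tree d).Adj (prodFun h u) (prodFun h (u ++ [x])) := by
    intro u x
    cases u with
    | nil => exact Or.inl ⟨x, by
        change x :: (h x).1 [] = [x]
        rw [show (h x).1 [] = [] from (h x).2]⟩
    | cons y w =>
      have h1 : (tree d).Adj ((h y).1 w) ((h y).1 (w ++ [x])) :=
        (h y).1.map_rel_iff.2 (Or.inl ⟨x, rfl⟩)
      rcases h1 with ⟨z, hz⟩ | ⟨z, hz⟩
      · exact Or.inl ⟨z, congrArg (List.cons y) hz⟩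
      · exact Or.inr ⟨z, congrArg (List.cons y) hz⟩
  rcases huv with ⟨x, rfl⟩ | ⟨x, rfl⟩
  · exact key u x
  · exact (key v x).symm

theorem prodFun_inv {d : ℕ} (h : Fin d → autT d) (u : List (Fin d)) :
    prodFun h⁻¹ (prodFun h u) = u := by
  cases u with
  | nil => rfl
  | cons x v => exact congrArg (List.cons x) ((h x).1.symm_apply_apply v)

/-- The map `(Aut T)^d → Aut T` sending `(h_1, …, h_d)` to the element of `St(1)` whose section at the
first-level vertex `x` is `h_x` for every `x`. -/
def prodHom (d : ℕ) : (Fin d → autT d) →* autT d where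
  toFun h :=
    ⟨{ toFun := prodFun h
       invFun := prodFun h⁻¹
       left_inv := prodFun_inv h
       right_inv := fun u => by simpa using prodFun_inv h⁻¹ u
       map_rel_iff' := fun {u v} =>
        ⟨fun huv => by simpa [prodFun_inv] using prodFun_adj h⁻¹ huv, prodFun_adj h⟩ }, rfl⟩
  map_one' := Subtype.ext <| RelIso.ext fun u => by cases u <;> rfl
  map_mul' f g := Subtype.ext <| RelIso.ext fun u => by cases u <;> rfl

/-- `(g_1, …, g_d)` with all `g_i ∈ H`: the subgroup `H × ⋯ × H` of `St(1)`. -/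
def power {d : ℕ} (H : Subgroup (autT d)) : Subgroup (autT d) :=
  (Subgroup.pi Set.univ fun _ : Fin d => H).map (prodHom d)

/-- The series `M_0, M_1, M_2, …` of subgroups of `Aut T_d`. The recursion
`M_{k+2} = M_k × ⋯ × M_k` starts with `k = 1`. -/
def M (d : ℕ) : ℕ → Subgroup (autT d)
  | 0 => ⊤
  | 1 => commutator (autT d)
  | 2 => commutator (autT d) ⊓ levelStab d 1
  | k + 3 => power (M d (k + 1))

/-- A subgroup is fully invariant if every endomorphism of the (abstract) group maps it into
itself. -/
def IsFullyInvariant {G : Type*} [Group G] (H : Subgroup G) : Prop :=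
  ∀ φ : G →* G, H.map φ ≤ H

/-- The verbal subgroup `w(G)`: the subgroup generated by all values of the word `w` in `G`. -/
def verbalSubgroup (G : Type*) [Group G] (w : FreeGroup ℕ) : Subgroup G :=
  Subgroup.closure (Set.range fun g : ℕ → G => FreeGroup.lift g w)

/-- A subgroup is verbal if it is `w(G)` for a single group word `w`. -/
def IsVerbal {G : Type*} [Group G] (H : Subgroup G) : Prop :=
  ∃ w : FreeGroup ℕ, H = verbalSubgroup G w

end RegularTree

noncomputable section

open scoped commutatorElement

namespace RegularTree

variable {d : ℕ}

/-! ### Automorphisms as maps on words -/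

/-! Write G for Aut T. Every element of G is a product of two involutions
(`exists_involution_mul_involution`), so the abelianization of G has exponent 2. An element outside
G' is therefore detected by a homomorphism to Z/2, and composing with Z/2 → G gives an endomorphism
sending it to any prescribed involution. Such endomorphisms can also be applied to all first-level
sections at once (`liftEnd`).

The core is a gap statement (`IsFullyInvariant.M_le`): a fully invariant H contained in `M d k` but
not in `M d (k + 1)` contains `M d k`. The cases k = 0, 1, 2 use, respectively, endomorphisms
through Z/2, normal subgroups of Sym(d), and lifted endomorphisms. Higher k reduce to the subgroup
of H supported on one first-level subtree. Since the series has trivial intersection, this gives the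
classification.

For verbality, a word with all values in `M d k` and some value outside `M d (k + 1)` suffices
(`exists_word`): its verbal subgroup is fully invariant, so the gap statement makes it equal to `M d
k`. The same words show strictness. -/

theorem autT_nil (g : autT d) : g.1 [] = [] := g.2

theorem autT_ext {g h : autT d} (H : ∀ u, g.1 u = h.1 u) : g = h :=
  Subtype.ext (RelIso.ext H)

theorem mul_apply (g h : autT d) (u : List (Fin d)) : (g * h).1 u = g.1 (h.1 u) := rfl

theorem one_apply (u : List (Fin d)) : (1 : autT d).1 u = u := rfl

theorem inv_apply_self (g : autT d) (u : List (Fin d)) : (g⁻¹).1 (g.1 u) = u :=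
  g.1.symm_apply_apply u

theorem apply_inv_self (g : autT d) (u : List (Fin d)) : g.1 ((g⁻¹).1 u) = u :=
  g.1.apply_symm_apply u

theorem apply_injective (g : autT d) : Function.Injective g.1 := g.1.injective

/-- Adjacency is undirected, so the image of a child could a priori be the parent of the image. At
the root there is no parent; below it, injectivity excludes this, since the parent is already the
image of the preceding vertex. -/
theorem exists_apply_append_singleton (g : autT d) (u : List (Fin d)) (x : Fin d) :
    ∃ y, g.1 (u ++ [x]) = g.1 u ++ [y] := by
  induction u using List.reverseRecOn generalizing x with
  | nil =>
    rcases g.1.map_rel_iff.2 (show (tree d).Adj [] ([] ++ [x]) from Or.inl ⟨x, rfl⟩) with h | ⟨y, h⟩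
    · exact h
    · rw [autT_nil] at h
      simp at h
  | append_singleton u z ih =>
    rcases g.1.map_rel_iff.2 (show (tree d).Adj (u ++ [z]) (u ++ [z] ++ [x]) from
      Or.inl ⟨x, rfl⟩) with h | ⟨y, h⟩
    · exact h
    · obtain ⟨z', hz⟩ := ih z
      rw [hz] at h
      have h1 := (List.append_inj' h rfl).1
      have := congrArg List.length (g.1.injective h1)
      simp at this

theorem exists_apply_singleton (g : autT d) (x : Fin d) : ∃ y, g.1 [x] = [y] := by
  obtain ⟨y, hy⟩ := exists_apply_append_singleton g [] x
  exact ⟨y, by simpa [autT_nil] using hy⟩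

/-- A permutation of the words that maps children of a vertex to children of its image. -/
def ofEquiv (e : List (Fin d) ≃ List (Fin d)) (h0 : e [] = [])
    (h : ∀ u x, ∃ y, e (u ++ [x]) = e u ++ [y]) : autT d :=
  have key : ∀ u v, (∃ x, e v = e u ++ [x]) → ∃ x, v = u ++ [x] := by
    rintro u v ⟨x, hx⟩
    induction v using List.reverseRecOn with
    | nil => rw [h0] at hx; simp at hx
    | append_singleton v z _ =>
      obtain ⟨y, hy⟩ := h v z
      rw [hy] at hx
      exact ⟨z, by rw [e.injective (List.append_inj' hx rfl).1]⟩
  have key' : ∀ u v, (∃ x, v = u ++ [x]) → ∃ x, e v = e u ++ [x] := by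
    rintro u v ⟨x, rfl⟩
    exact h u x
  ⟨{ toEquiv := e
     map_rel_iff' := fun {u v} => ⟨Or.imp (key u v) (key v u), Or.imp (key' u v) (key' v u)⟩ }, h0⟩

/-- The action of an automorphism on the letters, that is, on the first level. -/
def letter (g : autT d) (x : Fin d) : Fin d := (exists_apply_singleton g x).choose

theorem apply_singleton (g : autT d) (x : Fin d) : g.1 [x] = [letter g x] :=
  (exists_apply_singleton g x).choose_spec

theorem apply_cons_eq (g : autT d) (x : Fin d) (v : List (Fin d)) :
    g.1 (x :: v) = letter g x :: (g.1 (x :: v)).tail := by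
  induction v using List.reverseRecOn with
  | nil => simp [apply_singleton]
  | append_singleton v z ih =>
    obtain ⟨y, hy⟩ := exists_apply_append_singleton g (x :: v) z
    rw [← List.cons_append, hy, ih]
    simp

theorem letter_mul (g h : autT d) (x : Fin d) : letter (g * h) x = letter g (letter h x) := by
  have := apply_singleton (g * h) x
  rw [mul_apply, apply_singleton, apply_singleton] at this
  simpa using this.symm

theorem letter_one (x : Fin d) : letter (1 : autT d) x = x := by
  simpa [one_apply] using (apply_singleton (1 : autT d) x).symm

/-- The permutation of the first level induced by an automorphism. -/
def perm : autT d →* Equiv.Perm (Fin d) where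
  toFun g :=
    { toFun := letter g
      invFun := letter g⁻¹
      left_inv := fun x => by rw [← letter_mul, inv_mul_cancel, letter_one]
      right_inv := fun x => by rw [← letter_mul, mul_inv_cancel, letter_one] }
  map_one' := Equiv.ext letter_one
  map_mul' g h := Equiv.ext (letter_mul g h)

/-- The section of an automorphism at a first-level vertex. -/
def sec (g : autT d) (x : Fin d) : autT d :=
  ofEquiv
    { toFun := fun v => (g.1 (x :: v)).tail
      invFun := fun v => ((g⁻¹).1 (letter g x :: v)).tail
      left_inv := fun v => by
        dsimp only
        rw [← apply_cons_eq, inv_apply_self, List.tail_cons]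
      right_inv := fun v => by
        dsimp only
        have : x = letter g⁻¹ (letter g x) := by rw [← letter_mul, inv_mul_cancel, letter_one]
        nth_rewrite 1 [this]
        rw [← apply_cons_eq, apply_inv_self, List.tail_cons] }
    (by simp [apply_singleton])
    (fun u z => by
      obtain ⟨y, hy⟩ := exists_apply_append_singleton g (x :: u) z
      refine ⟨y, ?_⟩
      change (g.1 (x :: (u ++ [z]))).tail = (g.1 (x :: u)).tail ++ [y]
      rw [← List.cons_append, hy, apply_cons_eq]
      simp)

theorem apply_cons (g : autT d) (x : Fin d) (v : List (Fin d)) :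
    g.1 (x :: v) = perm g x :: (sec g x).1 v := apply_cons_eq g x v

theorem ext_perm_sec {g h : autT d} (hp : perm g = perm h) (hs : sec g = sec h) : g = h :=
  autT_ext fun u => by
    cases u with
    | nil => rw [autT_nil, autT_nil]
    | cons x v => rw [apply_cons, apply_cons, hp, hs]

theorem perm_eq_and_sec_eq {g : autT d} {x y : Fin d} {h : autT d}
    (H : ∀ v, g.1 (x :: v) = y :: h.1 v) : perm g x = y ∧ sec g x = h := by
  have H' : ∀ v, perm g x = y ∧ (sec g x).1 v = h.1 v := fun v => by
    have := H v
    rw [apply_cons] at this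
    simpa using this
  exact ⟨(H' []).1, autT_ext fun v => (H' v).2⟩

theorem sec_mul (g h : autT d) (x : Fin d) :
    sec (g * h) x = sec g (perm h x) * sec h x :=
  (perm_eq_and_sec_eq (y := perm g (perm h x)) fun v => by
    rw [mul_apply, apply_cons, apply_cons, mul_apply]).2

theorem sec_one (x : Fin d) : sec (1 : autT d) x = 1 :=
  (perm_eq_and_sec_eq (y := x) fun _ => rfl).2

theorem prodHom_cons (h : Fin d → autT d) (x : Fin d) (v : List (Fin d)) :
    (prodHom d h).1 (x :: v) = x :: (h x).1 v := rfl

theorem perm_prodHom (h : Fin d → autT d) : perm (prodHom d h) = 1 :=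
  Equiv.ext fun x => (perm_eq_and_sec_eq (prodHom_cons h x)).1

theorem sec_prodHom (h : Fin d → autT d) : sec (prodHom d h) = h :=
  funext fun x => (perm_eq_and_sec_eq (prodHom_cons h x)).2

theorem prodHom_injective : Function.Injective (prodHom d) := fun a b h => by
  rw [← sec_prodHom a, h, sec_prodHom]

/-- The automorphism that permutes the first-level subtrees rigidly. -/
def rooted : Equiv.Perm (Fin d) →* autT d where
  toFun σ := ofEquiv
    { toFun := fun u => u.modifyHead σ
      invFun := fun u => u.modifyHead σ.symm
      left_inv := fun u => by cases u <;> simp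
      right_inv := fun u => by cases u <;> simp }
    rfl
    (fun u x => by
      cases u with
      | nil => exact ⟨σ x, rfl⟩
      | cons y v => exact ⟨x, rfl⟩)
  map_one' := autT_ext fun u => by cases u <;> rfl
  map_mul' σ τ := autT_ext fun u => by cases u <;> rfl

theorem rooted_cons (σ : Equiv.Perm (Fin d)) (x : Fin d) (v : List (Fin d)) :
    (rooted σ).1 (x :: v) = σ x :: v := rfl

theorem perm_rooted (σ : Equiv.Perm (Fin d)) : perm (rooted σ) = σ :=
  Equiv.ext fun x => (perm_eq_and_sec_eq (h := 1) (rooted_cons σ x)).1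

theorem sec_rooted (σ : Equiv.Perm (Fin d)) (x : Fin d) : sec (rooted σ) x = 1 :=
  (perm_eq_and_sec_eq (h := 1) (rooted_cons σ x)).2

theorem eq_rooted_mul_prodHom (g : autT d) : g = rooted (perm g) * prodHom d (sec g) := by
  apply ext_perm_sec
  · rw [map_mul, perm_rooted, perm_prodHom, mul_one]
  · ext1 x
    rw [sec_mul, sec_rooted, one_mul, sec_prodHom]

theorem eq_prodHom_sec {g : autT d} (h : perm g = 1) : g = prodHom d (sec g) := by
  conv_lhs => rw [eq_rooted_mul_prodHom g, h, map_one, one_mul]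

theorem mem_levelStab_one {g : autT d} : g ∈ levelStab d 1 ↔ perm g = 1 := by
  constructor
  · intro h
    ext x
    have := h [x] rfl
    rw [apply_cons] at this
    simp at this
    simp [this.1]
  · intro h u hu
    obtain ⟨x, rfl⟩ := List.length_eq_one_iff.1 hu
    rw [apply_cons, h, autT_nil]
    rfl

theorem conj_prodHom (g : autT d) (h : Fin d → autT d) :
    g * prodHom d h * g⁻¹ =
      prodHom d fun x => sec g ((perm g)⁻¹ x) * h ((perm g)⁻¹ x) * (sec g ((perm g)⁻¹ x))⁻¹ := by
  rw [mul_inv_eq_iff_eq_mul]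
  apply ext_perm_sec
  · simp [perm_prodHom]
  · ext1 x
    simp [sec_mul, sec_prodHom, perm_prodHom]

/-- The automorphism acting as `g` on the subtree at the first-level vertex `x` and trivially
elsewhere. -/
def single (x : Fin d) : autT d →* autT d :=
  (prodHom d).comp (MonoidHom.mulSingle (fun _ : Fin d => autT d) x)

theorem single_eq (x : Fin d) (g : autT d) : single x g = prodHom d (Pi.mulSingle x g) := rfl

theorem conj_single (g : autT d) (x : Fin d) (a : autT d) :
    g * single x a * g⁻¹ = single (perm g x) (sec g x * a * (sec g x)⁻¹) := by
  rw [single_eq, conj_prodHom, single_eq]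
  congr 1
  ext1 y
  by_cases h : y = perm g x
  · subst h; simp
  · have h' : (perm g)⁻¹ y ≠ x := fun e => h (by rw [← e]; simp)
    rw [Pi.mulSingle_eq_of_ne h, Pi.mulSingle_eq_of_ne h']; simp

/-- Isolates one coordinate: a normal subgroup containing the tuple also contains this commutator.
-/
theorem commutator_prodHom_single (a : Fin d → autT d) (x : Fin d) (g : autT d) :
    ⁅prodHom d a, single x g⁆ = single x ⁅a x, g⁆ := by
  rw [single_eq, single_eq, ← map_commutatorElement]
  congr 1
  ext1 y
  by_cases h : y = x
  · subst h; simp [commutatorElement_def]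
  · simp [commutatorElement_def, Pi.mulSingle_eq_of_ne h]

theorem prodHom_eq_prod_single (h : Fin d → autT d) :
    prodHom d h = ((List.finRange d).map fun x => single x (h x)).prod := by
  have key : ∀ l : List (Fin d), l.Nodup → (l.map fun x => Pi.mulSingle x (h x)).prod =
      fun x => if x ∈ l then h x else 1 := by
    intro l hl
    induction l with
    | nil => ext1 x; simp
    | cons y l ih =>
      rw [List.nodup_cons] at hl
      rw [List.map_cons, List.prod_cons, ih hl.2]
      ext1 x
      by_cases hx : x = y
      · subst hx; simp [hl.1]
      · simp [hx]
  have h1 := key _ (List.nodup_finRange d)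
  simp only [List.mem_finRange, if_true] at h1
  rw [show (fun x => h x) = h from rfl] at h1
  rw [← congrArg (prodHom d) h1, map_list_prod, List.map_map]
  rfl

/-! ### Direct powers and lifted endomorphisms -/

theorem mem_power {H : Subgroup (autT d)} {g : autT d} :
    g ∈ power H ↔ ∃ a : Fin d → autT d, (∀ x, a x ∈ H) ∧ prodHom d a = g := by
  simp [power, Subgroup.mem_map, Subgroup.mem_pi]

theorem prodHom_mem_power {H : Subgroup (autT d)} {a : Fin d → autT d} :
    prodHom d a ∈ power H ↔ ∀ x, a x ∈ H := by
  rw [mem_power]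
  exact ⟨fun ⟨b, hb, e⟩ => prodHom_injective e ▸ hb, fun h => ⟨a, h, rfl⟩⟩

theorem single_mem_power {H : Subgroup (autT d)} {x : Fin d} {g : autT d} :
    single x g ∈ power H ↔ g ∈ H := by
  rw [single_eq, prodHom_mem_power]
  constructor
  · intro h; simpa using h x
  · intro h y
    by_cases hy : y = x
    · subst hy; simpa using h
    · rw [Pi.mulSingle_eq_of_ne hy]; exact one_mem H

/-- An endomorphism `φ` of `Aut T`, applied to all first-level sections. -/
def liftEnd (φ : autT d →* autT d) : autT d →* autT d where
  toFun g := rooted (perm g) * prodHom d fun x => φ (sec g x)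
  map_one' := by
    have : (fun x => φ (sec 1 x)) = (1 : Fin d → autT d) := by ext1 x; simp [sec_one]
    rw [this]; simp
  map_mul' g h := by
    apply ext_perm_sec
    · simp [perm_rooted, perm_prodHom]
    · ext1 x
      simp [sec_mul, sec_rooted, sec_prodHom, perm_prodHom, perm_rooted]

theorem liftEnd_prodHom (φ : autT d →* autT d) (a : Fin d → autT d) :
    liftEnd φ (prodHom d a) = prodHom d fun x => φ (a x) := by
  simp [liftEnd, perm_prodHom, sec_prodHom]

theorem liftEnd_single (φ : autT d →* autT d) (x : Fin d) (g : autT d) :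
    liftEnd φ (single x g) = single x (φ g) := by
  rw [single_eq, liftEnd_prodHom, single_eq]
  congr 1
  ext1 y
  by_cases hy : y = x
  · subst hy; simp
  · simp [Pi.mulSingle_eq_of_ne hy]

/-! ### Every automorphism is a product of two involutions -/

/-- Two words lie in the same orbit of the cyclic group generated by `g`. -/
def SameOrbit (g : autT d) (u v : List (Fin d)) : Prop := ∃ k : ℤ, (g ^ k).1 u = v

namespace SameOrbit

variable {g : autT d} {u v w : List (Fin d)}

theorem refl : SameOrbit g u u := ⟨0, by rw [zpow_zero, one_apply]⟩

theorem symm : SameOrbit g u v → SameOrbit g v u := by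
  rintro ⟨k, rfl⟩
  exact ⟨-k, by rw [zpow_neg, inv_apply_self]⟩

theorem trans : SameOrbit g u v → SameOrbit g v w → SameOrbit g u w := by
  rintro ⟨k, rfl⟩ ⟨l, rfl⟩
  exact ⟨l + k, by rw [zpow_add, mul_apply]⟩

theorem of_append_singleton {x y : Fin d} (h : SameOrbit g (u ++ [x]) (v ++ [y])) :
    SameOrbit g u v := by
  obtain ⟨k, hk⟩ := h
  obtain ⟨z, hz⟩ := exists_apply_append_singleton (g ^ k) u x
  rw [hz] at hk
  exact ⟨k, (List.append_inj' hk rfl).1⟩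

end SameOrbit

/-- `orbitRep g u.reverse` is a representative of the orbit of `u` under `g`, chosen such that the
representative of a child is a child of the representative of its parent. -/
def orbitRep (g : autT d) : List (Fin d) → List (Fin d)
  | [] => []
  | x :: v => orbitRep g v ++
      [@Classical.epsilon _ ⟨x⟩ fun y => SameOrbit g (orbitRep g v ++ [y]) (v.reverse ++ [x])]

theorem orbitRep_sameOrbit (g : autT d) (v : List (Fin d)) :
    SameOrbit g (orbitRep g v) v.reverse := by
  induction v with
  | nil => exact SameOrbit.refl
  | cons x v ih =>
    obtain ⟨k, hk⟩ := ih.symm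
    obtain ⟨y, hy⟩ := exists_apply_append_singleton (g ^ k) v.reverse x
    rw [hk] at hy
    have : ∃ y, SameOrbit g (orbitRep g v ++ [y]) (v.reverse ++ [x]) :=
      ⟨y, SameOrbit.symm ⟨k, hy⟩⟩
    rw [List.reverse_cons]
    exact Classical.epsilon_spec this

theorem orbitRep_eq (g : autT d) (u v : List (Fin d)) (h : SameOrbit g u.reverse v.reverse) :
    orbitRep g u = orbitRep g v := by
  induction u generalizing v with
  | nil =>
    obtain ⟨k, hk⟩ := h
    rw [List.reverse_nil, autT_nil] at hk
    rw [List.reverse_eq_nil_iff.1 hk.symm]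
  | cons x u ih =>
    cases v with
    | nil =>
      obtain ⟨k, hk⟩ := h.symm
      rw [List.reverse_nil, autT_nil] at hk
      simp at hk
    | cons y v =>
      rw [List.reverse_cons, List.reverse_cons] at h
      have e := ih v h.of_append_singleton
      -- The predicate depends only on the orbit, so `epsilon` makes the same choice for both words.
      have : (fun z => SameOrbit g (orbitRep g u ++ [z]) (u.reverse ++ [x])) =
          fun z => SameOrbit g (orbitRep g v ++ [z]) (v.reverse ++ [y]) := by
        ext z
        rw [e]
        exact ⟨fun H => H.trans h, fun H => H.trans h.symm⟩
      rw [orbitRep, orbitRep, this, e]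

/-- Every automorphism is a product of two involutions: the involution `g ^ k • b ↦ g ^ (-k) • b`, for
`b` running over the orbit representatives, conjugates `g` to its inverse. -/
theorem exists_involution_mul_involution (g : autT d) :
    ∃ s t : autT d, s * s = 1 ∧ t * t = 1 ∧ s * t = g := by
  set r : List (Fin d) → List (Fin d) := fun w => orbitRep g w.reverse
  have hr : ∀ w, ∃ k : ℤ, (g ^ k).1 (r w) = w := fun w => by
    have := orbitRep_sameOrbit g w.reverse
    rwa [List.reverse_reverse] at this
  have hrr : ∀ (k : ℤ) w, r ((g ^ k).1 w) = r w := fun k w =>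
    (orbitRep_eq g _ _ (by simpa using ⟨k, rfl⟩)).symm
  have hrs : ∀ w, r (r w) = r w := fun w => by
    obtain ⟨k, hk⟩ := hr w
    conv_rhs => rw [← hk, hrr]
  choose k hk using hr
  set τ : List (Fin d) → List (Fin d) := fun w => (g ^ (-k w)).1 (r w)
  -- Independence of the chosen exponent: applying `g ^ (k w + l)` to either side gives `w`.
  have hτ : ∀ (l : ℤ) w, (g ^ l).1 (r w) = w → τ w = (g ^ (-l)).1 (r w) := fun l w hl => by
    apply apply_injective (g ^ (k w + l))
    change (g ^ (k w + l)).1 ((g ^ (-k w)).1 (r w)) = _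
    rw [← mul_apply, ← mul_apply, ← zpow_add, ← zpow_add,
      show k w + l + -k w = l by ring, show k w + l + -l = k w by ring, hl, hk]
  have hrτ : ∀ w, r (τ w) = r w := fun w => by rw [hrr, hrs]
  have hττ : ∀ w, τ (τ w) = w := fun w => by
    rw [hτ (-k w) (τ w) (by rw [hrτ]), hrτ, neg_neg, hk]
  have hτg : ∀ w, τ (g.1 w) = (g⁻¹).1 (τ w) := fun w => by
    have h1 : r (g.1 w) = r w := by simpa using hrr 1 w
    rw [hτ (1 + k w) (g.1 w) (by rw [h1, zpow_add, mul_apply, hk, zpow_one]), h1, neg_add, zpow_add,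
      mul_apply, zpow_neg_one]
  let T : autT d := ofEquiv ⟨τ, τ, hττ, hττ⟩
    (by
      have : r [] = [] := rfl
      change (g ^ (-k [])).1 (r []) = []
      rw [this, autT_nil])
    (fun u x => by
      obtain ⟨y, hy⟩ : ∃ y, r (u ++ [x]) = r u ++ [y] := by
        simp only [r, List.reverse_append, List.reverse_singleton, List.singleton_append, orbitRep]
        exact ⟨_, rfl⟩
      have h1 := hk (u ++ [x])
      rw [hy] at h1
      obtain ⟨z, hz⟩ := exists_apply_append_singleton (g ^ k (u ++ [x])) (r u) y
      rw [hz] at h1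
      obtain ⟨z', hz'⟩ := exists_apply_append_singleton (g ^ (-k (u ++ [x]))) (r u) y
      refine ⟨z', ?_⟩
      change (g ^ (-k (u ++ [x]))).1 (r (u ++ [x])) = τ u ++ [z']
      -- The exponent chosen for the child also carries `r u` to `u`, so it may be used for the
      -- parent.
      rw [hy, hz', hτ _ u (List.append_inj' h1 rfl).1])
  have hT : ∀ u, T.1 u = τ u := fun _ => rfl
  have hTT : T * T = 1 := autT_ext fun u => by rw [mul_apply, hT, hT, hττ, one_apply]
  refine ⟨T, T * g, hTT, autT_ext fun u => ?_, by rw [← mul_assoc, hTT, one_mul]⟩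
  rw [mul_apply, mul_apply, mul_apply, hT, hT, hτg u, apply_inv_self, hττ, one_apply]

/-! ### Homomorphisms to the cyclic group of order two -/

theorem map_mul_self_eq_one {C : Type*} [CommGroup C] (f : autT d →* C) (g : autT d) :
    f g * f g = 1 := by
  obtain ⟨s, t, hs, ht, rfl⟩ := exists_involution_mul_involution g
  rw [← map_mul, show s * t * (s * t) = s * t * s * t by group, map_mul, map_mul, map_mul,
    mul_right_comm (f s), ← map_mul, hs, map_one, one_mul, ← map_mul, ht, map_one]

theorem abelianizationOf_eq_one {g : autT d} : Abelianization.of g = 1 ↔ g ∈ commutator (autT d) :=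
  QuotientGroup.eq_one_iff g

/-- The abelianization is a vector space over the field with two elements, where linear functionals
separate points. -/
theorem exists_hom_zmod_two {a : autT d} (ha : a ∉ commutator (autT d)) :
    ∃ f : autT d →* Multiplicative (ZMod 2), f a ≠ 1 := by
  have h2 : ∀ x : Additive (Abelianization (autT d)), 2 • x = 0 := fun x => by
    obtain ⟨g, hg⟩ := QuotientGroup.mk_surjective x.toMul
    have := map_mul_self_eq_one Abelianization.of g
    rw [two_nsmul]
    apply Additive.toMul.injective
    rw [toMul_add, ← hg]
    exact this
  let : Module (ZMod 2) (Additive (Abelianization (autT d))) := AddCommGroup.zmodModule h2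
  have hne : Additive.ofMul (Abelianization.of a) ≠ 0 := fun h => ha (abelianizationOf_eq_one.1 h)
  have hf : ¬ ∀ f : Module.Dual (ZMod 2) (Additive (Abelianization (autT d))),
      f (Additive.ofMul (Abelianization.of a)) = 0 := fun h =>
    hne ((Module.forall_dual_apply_eq_zero_iff (ZMod 2) _).1 h)
  push Not at hf
  obtain ⟨f, hf⟩ := hf
  exact ⟨(AddMonoidHom.toMultiplicativeRight f.toAddMonoidHom).comp Abelianization.of, hf⟩

theorem exists_hom_of_mul_self_eq_one {τ : autT d} (hτ : τ * τ = 1) :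
    ∃ ι : Multiplicative (ZMod 2) →* autT d, ∀ c, c ≠ 1 → ι c = τ := by
  let f : ℤ →+ Additive (autT d) := zmultiplesHom _ (Additive.ofMul τ)
  have hf : f (2 : ℕ) = 0 := by
    change (2 : ℤ) • Additive.ofMul τ = 0
    rw [two_zsmul, ← ofMul_mul, hτ, ofMul_one]
  refine ⟨AddMonoidHom.toMultiplicativeLeft (ZMod.lift 2 ⟨f, hf⟩), fun c hc => ?_⟩
  have hc1 : c = Multiplicative.ofAdd ((1 : ℤ) : ZMod 2) := by
    revert c; decide
  rw [hc1]
  change (ZMod.lift 2 ⟨f, hf⟩ ((1 : ℤ) : ZMod 2)).toMul = τ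
  rw [ZMod.lift_coe]
  simp [f]

theorem eq_top_of_involution_mem {H : Subgroup (autT d)} (h : ∀ τ : autT d, τ * τ = 1 → τ ∈ H) :
    H = ⊤ :=
  eq_top_iff.2 fun g _ => by
    obtain ⟨s, t, hs, ht, rfl⟩ := exists_involution_mul_involution g
    exact mul_mem (h s hs) (h t ht)

/-! ### Normal subgroups -/

theorem conj_rooted_single (σ : Equiv.Perm (Fin d)) (x : Fin d) (g : autT d) :
    rooted σ * single x g * (rooted σ)⁻¹ = single (σ x) g := by
  rw [conj_single, perm_rooted, sec_rooted, one_mul, inv_one, mul_one]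

theorem single_mem_of_single_mem {N : Subgroup (autT d)} [hN : N.Normal] {x : Fin d} (y : Fin d)
    {g : autT d} (h : single x g ∈ N) : single y g ∈ N := by
  have := hN.conj_mem _ h (rooted (Equiv.swap x y))
  rwa [conj_rooted_single, Equiv.swap_apply_left] at this

theorem exists_perm_apply_pair {x y x' y' : Fin d} (h : x ≠ y) (h' : x' ≠ y') :
    ∃ σ : Equiv.Perm (Fin d), σ x = x' ∧ σ y = y' := by
  refine ⟨Equiv.swap (Equiv.swap x x' y) y' * Equiv.swap x x', ?_, ?_⟩
  · rw [Equiv.Perm.mul_apply, Equiv.swap_apply_left]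
    refine Equiv.swap_apply_of_ne_of_ne (fun e => h ?_) h'
    apply (Equiv.swap x x').injective
    rw [Equiv.swap_apply_left, ← e]
  · rw [Equiv.Perm.mul_apply, Equiv.swap_apply_left]

theorem single_mul_inv_single_mem {N : Subgroup (autT d)} [hN : N.Normal] {x y : Fin d}
    (h : x ≠ y) {g : autT d} (hg : single x g * (single y g)⁻¹ ∈ N) (x' y' : Fin d) :
    single x' g * (single y' g)⁻¹ ∈ N := by
  by_cases h' : x' = y'
  · rw [h', mul_inv_cancel]; exact one_mem N
  · obtain ⟨σ, rfl, rfl⟩ := exists_perm_apply_pair h h'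
    have := hN.conj_mem _ hg (rooted σ)
    rwa [← conj_mul, conj_rooted_single, ← conj_inv, conj_rooted_single] at this

theorem commutator_le_comap {G H : Type*} [Group G] [Group H] (f : G →* H) :
    commutator G ≤ (commutator H).comap f := by
  rw [← Subgroup.map_le_iff_le_comap, commutator_def, Subgroup.map_commutator]
  exact Subgroup.commutator_mono le_top le_top

/-- The product over the first level of the classes of the sections modulo the derived subgroup. -/
def sectionsClass : autT d →* Abelianization (autT d) where
  toFun g := ∏ x, Abelianization.of (sec g x)
  map_one' := by simp [sec_one]
  map_mul' g h := by
    simp only [sec_mul, map_mul, Finset.prod_mul_distrib]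
    rw [Equiv.prod_comp (perm h) fun x => Abelianization.of (sec g x)]

theorem prod_of_eq_one {a : Fin d → autT d} (h : prodHom d a ∈ commutator (autT d)) :
    ∏ x, Abelianization.of (a x) = 1 := by
  have := Abelianization.commutator_subset_ker sectionsClass h
  rw [MonoidHom.mem_ker] at this
  simpa [sectionsClass, sec_prodHom] using this

theorem mem_M_two {g : autT d} : g ∈ M d 2 ↔ g ∈ commutator (autT d) ∧ perm g = 1 := by
  rw [← mem_levelStab_one]; rfl

theorem exists_of_mem_M_two {g : autT d} (h : g ∈ M d 2) :
    ∃ a : Fin d → autT d, g = prodHom d a ∧ ∏ x, Abelianization.of (a x) = 1 := by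
  rw [mem_M_two] at h
  have e := eq_prodHom_sec h.2
  exact ⟨sec g, e, prod_of_eq_one (e ▸ h.1)⟩

/-- Modulo N, `h2` moves all sections to the vertex `x`, where they multiply to a single element.
For a tuple in `M d 2` that element lies in the derived subgroup, so `h1` kills it. -/
theorem M_two_le_of_normal {N : Subgroup (autT d)} [hN : N.Normal] {x : Fin d}
    (h1 : ∀ z ∈ commutator (autT d), single x z ∈ N)
    (h2 : ∀ g y, single y g * (single x g)⁻¹ ∈ N) : M d 2 ≤ N := by
  intro g hg
  obtain ⟨a, rfl, ha⟩ := exists_of_mem_M_two hg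
  have h3 : ∀ y g, (QuotientGroup.mk' N) (single y g) = QuotientGroup.mk' N (single x g) :=
    fun y g => by
      rw [← mul_inv_eq_one, ← map_inv, ← map_mul]
      exact (QuotientGroup.eq_one_iff _).2 (h2 g y)
  have h4 : (List.map a (List.finRange d)).prod ∈ commutator (autT d) := by
    rw [← abelianizationOf_eq_one, map_list_prod, List.map_map, ← ha, Fin.prod_univ_def]
    rfl
  refine (QuotientGroup.eq_one_iff _).1 ?_
  change QuotientGroup.mk' N _ = 1
  rw [prodHom_eq_prod_single, map_list_prod, List.map_map]
  have h5 : ((QuotientGroup.mk' N) ∘ fun y => single y (a y)) =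
      fun y => ((QuotientGroup.mk' N).comp (single x)) (a y) := funext fun y => h3 y (a y)
  rw [h5]
  have h6 := map_list_prod ((QuotientGroup.mk' N).comp (single x)) (List.map a (List.finRange d))
  rw [List.map_map] at h6
  refine h6.symm.trans ?_
  exact (QuotientGroup.eq_one_iff _).2 (h1 _ h4)

/-- The commutator of `h` with an element supported below `x` lies in N and is supported below `x`
and its image. A second commutator, with an element supported below `x`, removes the coordinate at
the image. -/
theorem single_mem_of_perm_ne_one {N : Subgroup (autT d)} [hN : N.Normal] {h : autT d} (hh : h ∈ N)
    {x : Fin d} (hx : perm h x ≠ x) :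
    (∀ z ∈ commutator (autT d), single x z ∈ N) ∧
      ∀ g y, single y g * (single x g)⁻¹ ∈ N := by
  have h1 : ∀ g, single (perm h x) (sec h x * g * (sec h x)⁻¹) * (single x g)⁻¹ ∈ N := fun g => by
    rw [← conj_single, mul_assoc h, mul_assoc h]
    exact N.mul_mem hh (by simpa [mul_assoc] using hN.conj_mem _ (inv_mem hh) (single x g))
  have h2 : ∀ z ∈ commutator (autT d), single x z ∈ N := by
    intro z hz
    revert z
    change commutator (autT d) ≤ N.comap (single x)
    rw [commutator_def, Subgroup.commutator_le]
    intro g _ b _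
    have key : ∃ a : Fin d → autT d, prodHom d a ∈ N ∧ a x = g := by
      refine ⟨_, (map_mul (prodHom d) _ _ ▸ (by
        rw [map_inv]; exact h1 g⁻¹) :
        prodHom d (Pi.mulSingle (perm h x) (sec h x * g⁻¹ * (sec h x)⁻¹) *
          (Pi.mulSingle x g⁻¹)⁻¹) ∈ N), ?_⟩
      rw [Pi.mul_apply, Pi.mulSingle_eq_of_ne hx.symm, Pi.inv_apply, Pi.mulSingle_eq_same]
      simp
    obtain ⟨a, ha, rfl⟩ := key
    rw [Subgroup.mem_comap, ← commutator_prodHom_single, commutatorElement_def, mul_assoc, mul_assoc,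
      ← mul_assoc (single x b)]
    exact N.mul_mem ha (hN.conj_mem _ (inv_mem ha) _)
  refine ⟨h2, fun g y => ?_⟩
  refine single_mul_inv_single_mem hx ?_ y x
  -- This factor undoes the conjugation by `sec h x` in `h1 g`.
  have h3 : single (perm h x) ⁅g, sec h x⁆ ∈ N := single_mem_of_single_mem _
    (h2 _ (Subgroup.commutator_mem_commutator (Subgroup.mem_top _) (Subgroup.mem_top _)))
  have := N.mul_mem h3 (h1 g)
  rwa [← mul_assoc, ← map_mul, commutatorElement_def,
    show g * sec h x * g⁻¹ * (sec h x)⁻¹ * (sec h x * g * (sec h x)⁻¹) = g by group] at this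

/-! ### Normal subgroups acting nontrivially on the first level -/

/-- Oddness excludes d = 4, where the Klein four-group is a counterexample. -/
theorem alternatingGroup_le_of_normal_of_odd (hd : 3 ≤ d) (hodd : Odd d)
    {P : Subgroup (Equiv.Perm (Fin d))} [hP : P.Normal] {σ : Equiv.Perm (Fin d)} (hσ : σ ∈ P)
    (h1 : σ ≠ 1) : alternatingGroup (Fin d) ≤ P := by
  by_cases h5 : 5 ≤ d
  · exact Equiv.Perm.alternatingGroup_le_of_normal (by simpa using h5)
      ⟨⟨⟨σ, hσ⟩, 1, fun e => h1 (congrArg Subtype.val e)⟩⟩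
  · obtain rfl : d = 3 := by
      obtain ⟨m, rfl⟩ := hodd
      omega
    intro ρ hρ
    rw [Equiv.Perm.mem_alternatingGroup] at hρ
    have key : ∀ σ ρ : Equiv.Perm (Fin 3), σ ≠ 1 → Equiv.Perm.sign ρ = 1 →
        ρ = 1 ∨ ρ = σ ∨ ρ = σ * σ ∨ ∃ τ, ρ = σ * (τ * σ⁻¹ * τ⁻¹) := by decide
    rcases key σ ρ h1 hρ with rfl | rfl | rfl | ⟨τ, rfl⟩
    · exact one_mem P
    · exact hσ
    · exact mul_mem hσ hσ
    · exact mul_mem hσ (hP.conj_mem _ (inv_mem hσ) τ)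

theorem eq_one_of_forall_commute (hd : 3 ≤ d) {σ : Equiv.Perm (Fin d)}
    (h : ∀ τ, σ * τ = τ * σ) : σ = 1 := by
  by_contra hσ
  obtain ⟨x, hx⟩ : ∃ x, σ x ≠ x := by
    by_contra! H
    exact hσ (Equiv.ext H)
  obtain ⟨z, hz⟩ : ∃ z : Fin d, z ∉ ({x, σ x} : Finset (Fin d)) := by
    by_contra! H
    have h1 := Finset.card_le_two (a := x) (b := σ x)
    rw [Finset.eq_univ_of_forall H, Finset.card_univ, Fintype.card_fin] at h1
    omega
  simp only [Finset.mem_insert, Finset.mem_singleton, not_or] at hz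
  have := Equiv.ext_iff.1 (h (Equiv.swap (σ x) z)) x
  rw [Equiv.Perm.mul_apply, Equiv.Perm.mul_apply, Equiv.swap_apply_left,
    Equiv.swap_apply_of_ne_of_ne hx.symm (Ne.symm hz.1)] at this
  exact hz.2 this.symm

theorem exists_perm_commutator_ne_one (hd : 3 ≤ d) {h : autT d} (hh : perm h ≠ 1) :
    ∃ g : autT d, perm ⁅h, g⁆ ≠ 1 := by
  by_contra! H
  refine hh (eq_one_of_forall_commute hd fun τ => ?_)
  have := H (rooted τ)
  rwa [map_commutatorElement, perm_rooted, commutatorElement_eq_one_iff_mul_comm] at this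

/-- N contains `M d 2`, the kernel of the first-level action on G'. As Sym(d) is centreless, N ∩ G'
acts nontrivially on that level, so its image contains Alt(d), hence the image of G'. -/
theorem commutator_le_of_normal (hd : 3 ≤ d) (hodd : Odd d) {N : Subgroup (autT d)}
    [hN : N.Normal] {h : autT d} (hh : h ∈ N) (h1 : perm h ≠ 1) : commutator (autT d) ≤ N := by
  obtain ⟨x, hx⟩ : ∃ x, perm h x ≠ x := by
    by_contra! H
    exact h1 (Equiv.ext H)
  obtain ⟨ha, hb⟩ := single_mem_of_perm_ne_one hh hx
  have h2 : M d 2 ≤ N := M_two_le_of_normal ha hb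
  obtain ⟨b, hb⟩ := exists_perm_commutator_ne_one hd h1
  have hsurj : Function.Surjective (perm (d := d)) := fun σ => ⟨rooted σ, perm_rooted σ⟩
  have : ((N ⊓ commutator (autT d)).map perm).Normal := Subgroup.Normal.map inferInstance _ hsurj
  have hmem : ⁅h, b⁆ ∈ N ⊓ commutator (autT d) := by
    refine ⟨?_, Subgroup.commutator_mem_commutator (Subgroup.mem_top _) (Subgroup.mem_top _)⟩
    rw [commutatorElement_def, mul_assoc, mul_assoc, ← mul_assoc b]
    exact N.mul_mem hh (hN.conj_mem _ (inv_mem hh) _)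
  have hle := alternatingGroup_le_of_normal_of_odd hd hodd (Subgroup.mem_map_of_mem perm hmem) hb
  intro g hg
  have hg' : perm g ∈ alternatingGroup (Fin d) := by
    rw [alternatingGroup_eq_sign_ker]
    exact Abelianization.commutator_subset_ker (Equiv.Perm.sign.comp (perm (d := d))) hg
  obtain ⟨n, ⟨hn, hn'⟩, e⟩ := hle hg'
  have h3 : g * n⁻¹ ∈ N := h2 (mem_M_two.2 ⟨mul_mem hg (inv_mem hn'), by
    rw [map_mul, map_inv, e, mul_inv_cancel]⟩)
  simpa using mul_mem h3 hn

/-! ### The series `M` -/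

theorem M_add_three (k : ℕ) : M d (k + 3) = power (M d (k + 1)) := rfl

theorem power_mono {H K : Subgroup (autT d)} (h : H ≤ K) : power H ≤ power K := by
  intro g hg
  obtain ⟨a, ha, rfl⟩ := mem_power.1 hg
  exact prodHom_mem_power.2 fun x => h (ha x)

theorem M_three_le : M d 3 ≤ M d 2 := by
  intro g hg
  obtain ⟨a, ha, rfl⟩ := mem_power.1 hg
  refine mem_M_two.2 ⟨?_, perm_prodHom a⟩
  rw [prodHom_eq_prod_single]
  refine list_prod_mem fun z hz => ?_
  obtain ⟨x, -, rfl⟩ := List.mem_map.1 hz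
  exact commutator_le_comap (single x) (ha x)

theorem M_succ_le : ∀ k, M d (k + 1) ≤ M d k
  | 0 => le_top
  | 1 => inf_le_left
  | 2 => M_three_le
  | k + 3 => power_mono (M_succ_le (k + 1))

/-- Two steps of the series descend one level; hence the series has trivial intersection. -/
theorem M_le_levelStab (k : ℕ) : M d (2 * k + 1) ≤ levelStab d k := by
  induction k with
  | zero =>
    intro _ _ u hu
    rw [List.length_eq_zero_iff.1 hu, autT_nil]
  | succ k ih =>
    intro g hg u hu
    rw [show 2 * (k + 1) + 1 = 2 * k + 3 by ring, M_add_three] at hg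
    obtain ⟨a, ha, rfl⟩ := mem_power.1 hg
    cases u with
    | nil => rfl
    | cons x v => rw [prodHom_cons, ih (ha x) v (by simpa using hu)]

theorem eq_bot_of_forall_le_M {H : Subgroup (autT d)} (h : ∀ k, H ≤ M d k) : H = ⊥ :=
  (Subgroup.eq_bot_iff_forall H).2 fun _ hg =>
    autT_ext fun u => M_le_levelStab u.length (h _ hg) u rfl

theorem of_pow_of_odd (hodd : Odd d) (g : autT d) :
    Abelianization.of g ^ d = Abelianization.of g := by
  obtain ⟨m, rfl⟩ := hodd
  rw [pow_succ, pow_mul, sq, map_mul_self_eq_one, one_pow, one_mul]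

/-- No nontrivial element of `M d (k + 1)` modulo `M d (k + 2)` is central in the quotient of G. For
k = 0, Sym(d) is centreless. For k = 1, commuting with transpositions forces all sections into one
class c modulo G', and the product condition reads 1 = c ^ d = c, d being odd. Beyond that, elements
supported on one subtree reduce to a section. -/
theorem mem_M_succ_of_commutator_mem (hd : 3 ≤ d) (hodd : Odd d) : ∀ (k : ℕ) (h : autT d),
    h ∈ M d (k + 1) → (∀ g, ⁅h, g⁆ ∈ M d (k + 2)) → h ∈ M d (k + 2)
  | 0, h, hh, H => by
    refine mem_M_two.2 ⟨hh, ?_⟩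
    by_contra h1
    obtain ⟨g, hg⟩ := exists_perm_commutator_ne_one hd h1
    exact hg (mem_M_two.1 (H g)).2
  | 1, h, hh, H => by
    obtain ⟨a, rfl, ha⟩ := exists_of_mem_M_two hh
    refine prodHom_mem_power.2 fun x => abelianizationOf_eq_one.1 ?_
    have key : ∀ y, Abelianization.of (a y) = Abelianization.of (a x) := fun y => by
      have h1 : ⁅prodHom d a, rooted (Equiv.swap x y)⁆ =
          prodHom d (a * fun z => (a (Equiv.swap x y z))⁻¹) := by
        rw [commutatorElement_def, mul_assoc, mul_assoc, ← mul_assoc (rooted _), ← map_inv,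
          conj_prodHom, map_mul]
        simp [sec_rooted, perm_rooted]
      have h2 := H (rooted (Equiv.swap x y))
      rw [h1] at h2
      have h3 := prodHom_mem_power.1 h2 y
      rw [M, ← abelianizationOf_eq_one] at h3
      simpa [mul_inv_eq_one] using h3
    rw [Finset.prod_congr rfl fun y _ => key y, Finset.prod_const, Finset.card_univ,
      Fintype.card_fin, of_pow_of_odd hodd] at ha
    exact ha
  | k + 2, h, hh, H => by
    obtain ⟨a, ha, rfl⟩ := mem_power.1 hh
    refine prodHom_mem_power.2 fun x => mem_M_succ_of_commutator_mem hd hodd k _ (ha x) fun g => ?_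
    have := H (single x g)
    rw [commutator_prodHom_single] at this
    exact single_mem_power.1 this

/-! ### Fully invariant subgroups -/

theorem IsFullyInvariant.map_mem {G : Type*} [Group G] {H : Subgroup G} (hH : IsFullyInvariant H)
    (φ : G →* G) {g : G} (hg : g ∈ H) : φ g ∈ H :=
  hH φ (Subgroup.mem_map_of_mem φ hg)

theorem IsFullyInvariant.normal {G : Type*} [Group G] {H : Subgroup G} (hH : IsFullyInvariant H) :
    H.Normal :=
  ⟨fun _ hn g => hH.map_mem (MulAut.conj g).toMonoidHom hn⟩

theorem IsFullyInvariant.comap_single {H : Subgroup (autT d)} (hH : IsFullyInvariant H)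
    (x : Fin d) : IsFullyInvariant (H.comap (single x)) := by
  rintro φ _ ⟨g, hg, rfl⟩
  have := hH.map_mem (liftEnd φ) hg
  rwa [liftEnd_single] at this

theorem IsFullyInvariant.eq_top {H : Subgroup (autT d)} (hH : IsFullyInvariant H) {a : autT d}
    (ha : a ∈ H) (ha' : a ∉ commutator (autT d)) : H = ⊤ := by
  obtain ⟨f, hf⟩ := exists_hom_zmod_two ha'
  refine eq_top_of_involution_mem fun τ hτ => ?_
  obtain ⟨ι, hι⟩ := exists_hom_of_mul_self_eq_one hτ
  simpa [hι _ hf] using hH.map_mem (ι.comp f) ha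

/-- As d is odd and the classes multiply to 1, a homomorphism to Z/2 nontrivial at `a x` is trivial
at some `a y`. Lifting it through an involution τ turns all sections into 1 or τ; dividing the
conjugate under the swap of `x` and `y` by the tuple itself leaves only these two coordinates. -/
theorem IsFullyInvariant.M_two_le (hd : 3 ≤ d) (hodd : Odd d) {H : Subgroup (autT d)}
    (hH : IsFullyInvariant H) {a : Fin d → autT d} (ha : prodHom d a ∈ H)
    (hprod : ∏ x, Abelianization.of (a x) = 1) {x : Fin d} (hx : a x ∉ commutator (autT d)) :
    M d 2 ≤ H := by
  have hN := hH.normal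
  obtain ⟨f, hf⟩ := exists_hom_zmod_two hx
  obtain ⟨y, hy⟩ : ∃ y, f (a y) = 1 := by
    by_contra! hne
    have h1 : ∀ y, f (a y) = f (a x) := fun y => by
      have : ∀ c e : Multiplicative (ZMod 2), c ≠ 1 → e ≠ 1 → c = e := by decide
      exact this _ _ (hne y) hf
    have h2 : ∏ y, f (a y) = 1 := by
      have := congrArg (Abelianization.lift f) hprod
      simpa [map_prod] using this
    rw [Finset.prod_congr rfl fun y _ => h1 y, Finset.prod_const, Finset.card_univ,
      Fintype.card_fin] at h2
    obtain ⟨m, rfl⟩ := hodd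
    rw [pow_succ, pow_mul, sq, map_mul_self_eq_one, one_pow, one_mul] at h2
    exact hf h2
  have hxy : y ≠ x := by
    rintro rfl
    exact hf hy
  have key : ∀ τ : autT d, τ * τ = 1 → single y τ * (single x τ)⁻¹ ∈ H := by
    intro τ hτ
    obtain ⟨ι, hι⟩ := exists_hom_of_mul_self_eq_one hτ
    have h1 := hH.map_mem (liftEnd (ι.comp f)) ha
    rw [liftEnd_prodHom] at h1
    have h2 := H.mul_mem (hN.conj_mem _ h1 (rooted (Equiv.swap x y))) (inv_mem h1)
    convert h2 using 1
    rw [conj_prodHom, single_eq, single_eq, ← map_inv (prodHom d), ← map_inv (prodHom d),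
      ← map_mul, ← map_mul]
    congr 1
    ext1 z
    by_cases hzx : z = x
    · subst hzx
      simp [perm_rooted, sec_rooted, hy, hι _ hf, Pi.mulSingle_eq_of_ne hxy.symm]
    · by_cases hzy : z = y
      · subst hzy
        simp [perm_rooted, sec_rooted, hy, hι _ hf, Pi.mulSingle_eq_of_ne hxy]
      · simp [perm_rooted, sec_rooted, Pi.mulSingle_eq_of_ne hzx, Pi.mulSingle_eq_of_ne hzy,
          Equiv.swap_apply_of_ne_of_ne hzx hzy]
  have key' : ∀ g z, single z g * (single x g)⁻¹ ∈ H := by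
    intro g z
    obtain ⟨s, t, hs, ht, rfl⟩ := exists_involution_mul_involution g
    have h1 := single_mul_inv_single_mem hxy (key s hs) z x
    have h2 := single_mul_inv_single_mem hxy (key t ht) z x
    have h3 := H.mul_mem (hN.conj_mem _ h2 (single z s)) h1
    rw [map_mul, map_mul]
    convert h3 using 1
    group
  refine M_two_le_of_normal (x := x) ?_ key'
  obtain ⟨σ, hσ⟩ : ∃ σ : Equiv.Perm (Fin d), σ ≠ 1 := ⟨Equiv.swap y x, fun e => hxy (by
    simpa using congrArg (fun ρ : Equiv.Perm (Fin d) => ρ x) e)⟩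
  obtain ⟨b, hb⟩ := exists_perm_commutator_ne_one hd (h := rooted σ) (by rwa [perm_rooted])
  have hK : (H.comap (single x)).Normal := hN.comap _
  refine commutator_le_of_normal hd hodd (h := ⁅rooted σ, b⁆) (N := H.comap (single x)) ?_ hb
  -- An element of H with section `rooted σ` at `x`: its commutator gives an element below `x` alone
  -- whose section moves the first level.
  have h1 : ⁅prodHom d (Pi.mulSingle y (rooted σ)⁻¹ * Pi.mulSingle x (rooted σ)), single x b⁆ ∈ H := by
    have h2 : prodHom d (Pi.mulSingle y (rooted σ)⁻¹ * Pi.mulSingle x (rooted σ)) ∈ H := by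
      have := key' (rooted σ)⁻¹ y
      rwa [← map_inv (single x), inv_inv, single_eq, single_eq, ← map_mul] at this
    rw [commutatorElement_def, mul_assoc, mul_assoc, ← mul_assoc (single x b)]
    exact H.mul_mem h2 (hN.conj_mem _ (inv_mem h2) _)
  rw [commutator_prodHom_single] at h1
  simpa [Pi.mulSingle_eq_of_ne hxy.symm] using h1

/-- In the recursive case, commutators bring elements of H into one subtree. They cannot all fall
into the next term there, by `mem_M_succ_of_commutator_mem`, so induction applies to the pullback of
H along `single x`. -/
theorem IsFullyInvariant.M_le (hd : 3 ≤ d) (hodd : Odd d) : ∀ (k : ℕ) {H : Subgroup (autT d)},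
    IsFullyInvariant H → H ≤ M d k → ¬ H ≤ M d (k + 1) → M d k ≤ H
  | 0, H, hH, _, hn => by
    obtain ⟨a, ha, ha'⟩ := SetLike.not_le_iff_exists.1 hn
    rw [hH.eq_top ha ha']
    exact le_top
  | 1, H, hH, hle, hn => by
    have := hH.normal
    obtain ⟨a, ha, ha'⟩ := SetLike.not_le_iff_exists.1 hn
    exact commutator_le_of_normal hd hodd ha fun h1 => ha' (mem_M_two.2 ⟨hle ha, h1⟩)
  | 2, H, hH, hle, hn => by
    obtain ⟨g, ha, ha'⟩ := SetLike.not_le_iff_exists.1 hn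
    obtain ⟨a, rfl, hprod⟩ := exists_of_mem_M_two (hle ha)
    rw [M_add_three, prodHom_mem_power, not_forall] at ha'
    obtain ⟨x, hx⟩ := ha'
    exact hH.M_two_le hd hodd ha hprod hx
  | k + 3, H, hH, hle, hn => by
    have hN := hH.normal
    obtain ⟨h, hh, hh'⟩ := SetLike.not_le_iff_exists.1 hn
    obtain ⟨a, ha, rfl⟩ := mem_power.1 (hle hh)
    rw [M_add_three, prodHom_mem_power, not_forall] at hh'
    obtain ⟨x, hx⟩ := hh'
    have hK : M d (k + 1) ≤ H.comap (single x) := by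
      refine IsFullyInvariant.M_le hd hodd (k + 1) (hH.comap_single x)
        (fun g hg => single_mem_power.1 (hle hg)) fun hK => hx ?_
      refine mem_M_succ_of_commutator_mem hd hodd k _ (ha x) fun g => hK ?_
      rw [Subgroup.mem_comap, ← commutator_prodHom_single, commutatorElement_def, mul_assoc,
        mul_assoc, ← mul_assoc (single x g)]
      exact H.mul_mem hh (hN.conj_mem _ (inv_mem hh) _)
    intro g hg
    obtain ⟨b, hb, rfl⟩ := mem_power.1 hg
    rw [prodHom_eq_prod_single]
    refine list_prod_mem fun z hz => ?_
    obtain ⟨y, -, rfl⟩ := List.mem_map.1 hz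
    exact single_mem_of_single_mem y (hK (hb y))

theorem IsFullyInvariant.eq_bot_or_exists_eq_M (hd : 3 ≤ d) (hodd : Odd d)
    {H : Subgroup (autT d)} (hH : IsFullyInvariant H) : H = ⊥ ∨ ∃ k, H = M d k := by
  by_cases h : ∀ k, H ≤ M d k
  · exact Or.inl (eq_bot_of_forall_le_M h)
  · right
    classical
    push Not at h
    have h0 : Nat.find h ≠ 0 := fun e => by
      have := Nat.find_spec h
      rw [e] at this
      exact this le_top
    obtain ⟨k, hk⟩ := Nat.exists_eq_succ_of_ne_zero h0
    have h1 : H ≤ M d k := by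
      by_contra hc
      have := Nat.find_min' h hc
      omega
    have h2 := Nat.find_spec h
    rw [hk] at h2
    exact ⟨k, le_antisymm h1 (hH.M_le hd hodd k h1 h2)⟩

/-! ### Verbal subgroups -/

theorem lift_mem_verbalSubgroup {G : Type*} [Group G] (w : FreeGroup ℕ) (g : ℕ → G) :
    FreeGroup.lift g w ∈ verbalSubgroup G w :=
  Subgroup.subset_closure ⟨g, rfl⟩

theorem map_lift {G K : Type*} [Group G] [Group K] (φ : G →* K) (g : ℕ → G) (w : FreeGroup ℕ) :
    φ (FreeGroup.lift g w) = FreeGroup.lift (fun i => φ (g i)) w :=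
  DFunLike.congr_fun (FreeGroup.ext_hom _ _ fun i => by simp :
    φ.comp (FreeGroup.lift g) = FreeGroup.lift fun i => φ (g i)) w

theorem isFullyInvariant_verbalSubgroup {G : Type*} [Group G] (w : FreeGroup ℕ) :
    IsFullyInvariant (verbalSubgroup G w) := by
  intro φ
  rw [verbalSubgroup, MonoidHom.map_closure, Subgroup.closure_le]
  rintro _ ⟨_, ⟨g, rfl⟩, rfl⟩
  change φ (FreeGroup.lift g w) ∈ _
  rw [map_lift]
  exact lift_mem_verbalSubgroup w _

theorem IsVerbal.isFullyInvariant {G : Type*} [Group G] {H : Subgroup G} (h : IsVerbal H) :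
    IsFullyInvariant H := by
  obtain ⟨w, rfl⟩ := h
  exact isFullyInvariant_verbalSubgroup w

theorem isVerbal_bot {G : Type*} [Group G] : IsVerbal (⊥ : Subgroup G) :=
  ⟨1, by simp [verbalSubgroup, Subgroup.closure_singleton_one]⟩

/-! ### Words with values in a prescribed term of the series -/

theorem sec_pow_of_perm_eq {Y : autT d} {x : Fin d} (h : perm Y x = x) (t : ℕ) :
    sec (Y ^ t) x = sec Y x ^ t := by
  induction t with
  | zero => rw [pow_zero, pow_zero, sec_one]
  | succ t ih => rw [pow_succ, sec_mul, h, ih, pow_succ]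

/-- A wreath power of a permutation `c`: along a cycle of `c` of length `minimalPeriod c x`, the
sections of `rooted c * single x g` multiply to `g`. -/
theorem sec_pow_minimalPeriod (c : Equiv.Perm (Fin d)) (x : Fin d) (g : autT d) (n : ℕ)
    (hn : n < Function.minimalPeriod c x) : sec ((rooted c * single x g) ^ (n + 1)) x = g := by
  have hp : perm (rooted c * single x g) = c := by
    rw [map_mul, perm_rooted, single_eq, perm_prodHom, mul_one]
  induction n with
  | zero =>
    rw [zero_add, pow_one, sec_mul, sec_rooted, one_mul, single_eq, sec_prodHom,
      Pi.mulSingle_eq_same]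
  | succ n ih =>
    have h1 : (c ^ (n + 1)) x ≠ x := fun e =>
      Function.not_isPeriodicPt_of_pos_of_lt_minimalPeriod n.succ_ne_zero hn
        (by rw [Function.IsPeriodicPt, Equiv.Perm.iterate_eq_pow]; exact e)
    rw [pow_succ', sec_mul, ih (by omega), sec_mul, sec_rooted, one_mul, map_pow, hp, single_eq,
      sec_prodHom, Pi.mulSingle_eq_of_ne h1, one_mul]

/-- Take for e the exponent of Sym(d), which is even. Some cycle length ℓ contains the full power of
2 in e, so e = ℓt with t odd. The wreath power along that cycle has section g at `x` after ℓ steps,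
hence g ^ t = g after e steps if g is an involution. -/
theorem exists_pow_mem_M_two (hd : 3 ≤ d) : ∃ (e : ℕ) (x : Fin d), (∀ g : autT d, g ^ e ∈ M d 2) ∧
    ∀ g : autT d, g * g = 1 → ∃ X : autT d, sec (X ^ e) x = g := by
  have he0 : Monoid.exponent (Equiv.Perm (Fin d)) ≠ 0 := Monoid.exponent_ne_zero_of_finite
  have hne : (⟨0, by omega⟩ : Fin d) ≠ ⟨1, by omega⟩ := by simp
  have h2 : orderOf (Equiv.swap (⟨0, by omega⟩ : Fin d) ⟨1, by omega⟩) = 2 :=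
    orderOf_eq_prime (by rw [sq, Equiv.swap_mul_self]) fun h =>
      hne ((Equiv.swap_apply_right _ _).symm.trans (Equiv.ext_iff.1 h ⟨1, by omega⟩))
  obtain ⟨m, hm⟩ : 2 ∣ Monoid.exponent (Equiv.Perm (Fin d)) := h2 ▸ Monoid.order_dvd_exponent _
  -- Here m is half the exponent, so it does not annihilate Sym(d).
  obtain ⟨c, hc⟩ : ∃ c : Equiv.Perm (Fin d), c ^ m ≠ 1 := by
    by_contra! H
    have h1 := Nat.le_of_dvd (by omega) (Monoid.exponent_dvd_of_forall_pow_eq_one H)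
    omega
  obtain ⟨x, hx⟩ : ∃ x, (c ^ m) x ≠ x := by
    by_contra! H
    exact hc (Equiv.ext H)
  have hper : ∀ n, (c ^ n) x = x ↔ Function.minimalPeriod c x ∣ n := fun n => by
    rw [← Function.isPeriodicPt_iff_minimalPeriod_dvd, Function.IsPeriodicPt, Function.IsFixedPt,
      Equiv.Perm.iterate_eq_pow]
  have hce : (c ^ Monoid.exponent (Equiv.Perm (Fin d))) x = x := by
    rw [Monoid.pow_exponent_eq_one, Equiv.Perm.one_apply]
  obtain ⟨t, ht⟩ := (hper _).1 hce
  have hodd : Odd t := by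
    rw [← Nat.not_even_iff_odd]
    rintro ⟨s, rfl⟩
    refine hx ((hper m).2 ⟨s, ?_⟩)
    rw [hm] at ht
    linarith
  have hpos : 0 < Function.minimalPeriod c x := by
    rcases Nat.eq_zero_or_pos (Function.minimalPeriod c x) with h | h
    · rw [h, zero_mul] at ht
      exact absurd ht he0
    · exact h
  refine ⟨Monoid.exponent (Equiv.Perm (Fin d)), x, fun g => mem_M_two.2 ⟨?_, ?_⟩, fun g hg => ?_⟩
  · rw [← abelianizationOf_eq_one, map_pow, hm, pow_mul, sq, map_mul_self_eq_one, one_pow]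
  · rw [map_pow, Monoid.pow_exponent_eq_one]
  · refine ⟨rooted c * single x g, ?_⟩
    rw [ht, pow_mul, sec_pow_of_perm_eq]
    · obtain ⟨n, hn⟩ := Nat.exists_eq_succ_of_ne_zero hpos.ne'
      rw [hn, Nat.succ_eq_add_one, sec_pow_minimalPeriod c x g n (by omega)]
      obtain ⟨s, rfl⟩ := hodd
      rw [pow_succ, pow_mul, sq, hg, one_pow, one_mul]
    · rw [map_pow, map_mul, perm_rooted, single_eq, perm_prodHom, mul_one]
      exact (hper _).2 dvd_rfl

theorem exists_not_mem_commutator (hd : 3 ≤ d) : ∃ g : autT d, g ∉ commutator (autT d) := by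
  have hne : (⟨0, by omega⟩ : Fin d) ≠ ⟨1, by omega⟩ := by simp
  refine ⟨rooted (Equiv.swap ⟨0, by omega⟩ ⟨1, by omega⟩), fun h => ?_⟩
  have h1 := Abelianization.commutator_subset_ker (Equiv.Perm.sign.comp (perm (d := d))) h
  rw [MonoidHom.mem_ker, MonoidHom.comp_apply, perm_rooted, Equiv.Perm.sign_swap hne] at h1
  exact absurd h1 (by decide)

/-- Products of two e-th powers lie in `M d 2`, yet their sections at `x` take every value, each
element being a product of two involutions. Substituting such products, in disjoint variables, into
a word for k + 1 evaluates that word in the sections and gives a word for k + 3. -/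
theorem exists_word (hd : 3 ≤ d) : ∀ k : ℕ, ∃ w : FreeGroup ℕ,
    (∀ g : ℕ → autT d, FreeGroup.lift g w ∈ M d k) ∧
      ∃ g : ℕ → autT d, FreeGroup.lift g w ∉ M d (k + 1)
  | 0 => by
    obtain ⟨g, hg⟩ := exists_not_mem_commutator hd
    exact ⟨FreeGroup.of 0, fun _ => Subgroup.mem_top _, fun _ => g, by rw [FreeGroup.lift_apply_of]; exact hg⟩
  | 1 => by
    have hne : (⟨0, by omega⟩ : Fin d) ≠ ⟨1, by omega⟩ := by simp
    obtain ⟨b, hb⟩ := exists_perm_commutator_ne_one hd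
      (h := rooted (Equiv.swap (⟨0, by omega⟩ : Fin d) ⟨1, by omega⟩)) (by
        rw [perm_rooted]
        intro e
        exact hne ((Equiv.swap_apply_right _ _).symm.trans (Equiv.ext_iff.1 e ⟨1, by omega⟩)))
    refine ⟨⁅FreeGroup.of 0, FreeGroup.of 1⁆, fun g => ?_,
      fun i => if i = 0 then rooted (Equiv.swap ⟨0, by omega⟩ ⟨1, by omega⟩) else b, fun h => hb ?_⟩
    · rw [map_commutatorElement]
      exact Subgroup.commutator_mem_commutator (Subgroup.mem_top _) (Subgroup.mem_top _)
    · simpa only [map_commutatorElement, FreeGroup.lift_apply_of, if_true, one_ne_zero, if_false]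
        using (mem_M_two.1 h).2
  | 2 => by
    obtain ⟨e, x, he, hX⟩ := exists_pow_mem_M_two hd
    obtain ⟨g, hg⟩ := exists_not_mem_commutator hd
    obtain ⟨s, t, hs, ht, rfl⟩ := exists_involution_mul_involution g
    obtain ⟨X, rfl⟩ := hX s hs
    obtain ⟨Y, rfl⟩ := hX t ht
    refine ⟨FreeGroup.of 0 ^ e * FreeGroup.of 1 ^ e, fun g => ?_, fun i => if i = 0 then X else Y,
      fun h => hg ?_⟩
    · simpa using mul_mem (he _) (he _)
    · simp only [map_mul, map_pow, FreeGroup.lift_apply_of, if_true, one_ne_zero, if_false] at h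
      rw [eq_prodHom_sec (mem_M_two.1 (mul_mem (he X) (he Y))).2, M_add_three,
        prodHom_mem_power] at h
      have := h x
      rwa [sec_mul, (mem_M_two.1 (he Y)).2] at this
  | k + 3 => by
    obtain ⟨w, hw, g, hg⟩ := exists_word hd (k + 1)
    obtain ⟨e, x, he, hX⟩ := exists_pow_mem_M_two hd
    have key : ∀ b : ℕ → autT d, FreeGroup.lift b (FreeGroup.lift
        (fun i => FreeGroup.of (2 * i) ^ e * FreeGroup.of (2 * i + 1) ^ e) w) =
        prodHom d fun z => FreeGroup.lift (fun i => sec (b (2 * i) ^ e * b (2 * i + 1) ^ e) z) w := by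
      intro b
      rw [map_lift]
      simp only [map_mul, map_pow, FreeGroup.lift_apply_of]
      have h1 : (fun i => b (2 * i) ^ e * b (2 * i + 1) ^ e) =
          fun i => prodHom d (sec (b (2 * i) ^ e * b (2 * i + 1) ^ e)) := funext fun i =>
        eq_prodHom_sec (mem_M_two.1 (mul_mem (he _) (he _))).2
      rw [h1, ← map_lift]
      congr 1
      ext1 z
      exact map_lift (Pi.evalMonoidHom (fun _ : Fin d => autT d) z) _ w
    have hXY : ∀ i, ∃ X Y : autT d, sec (X ^ e * Y ^ e) x = g i := fun i => by
      obtain ⟨s, t, hs, ht, hst⟩ := exists_involution_mul_involution (g i)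
      obtain ⟨X, rfl⟩ := hX s hs
      obtain ⟨Y, rfl⟩ := hX t ht
      exact ⟨X, Y, by rw [sec_mul, (mem_M_two.1 (he Y)).2, ← hst, Equiv.Perm.one_apply]⟩
    choose X Y hXY using hXY
    refine ⟨FreeGroup.lift (fun i => FreeGroup.of (2 * i) ^ e * FreeGroup.of (2 * i + 1) ^ e) w,
      fun b => ?_, fun i => if i % 2 = 0 then X (i / 2) else Y (i / 2), fun h => hg ?_⟩
    · rw [key, M_add_three, prodHom_mem_power]
      exact fun z => hw _
    · rw [key, show k + 3 + 1 = k + 1 + 3 by ring, M_add_three, prodHom_mem_power] at h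
      have h1 := h x
      have h2 : ∀ i, 2 * i / 2 = i := fun i => by omega
      have h3 : ∀ i, (2 * i + 1) / 2 = i := fun i => by omega
      have h4 : ∀ i, (2 * i + 1) % 2 ≠ 0 := fun i => by omega
      have h5 : ∀ i, 2 * i % 2 = 0 := fun i => by omega
      simp only [h2, h3, if_neg (h4 _), if_pos (h5 _), hXY] at h1
      exact h1

theorem isVerbal_M (hd : 3 ≤ d) (hodd : Odd d) (k : ℕ) : IsVerbal (M d k) := by
  obtain ⟨w, hw, g, hg⟩ := exists_word hd k
  have h1 : verbalSubgroup (autT d) w ≤ M d k := by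
    rw [verbalSubgroup, Subgroup.closure_le]
    rintro _ ⟨g, rfl⟩
    exact hw g
  exact ⟨w, le_antisymm ((isFullyInvariant_verbalSubgroup w).M_le hd hodd k h1
    fun h => hg (h (lift_mem_verbalSubgroup w g))) h1⟩

theorem M_strictAnti (hd : 3 ≤ d) : StrictAnti (M d) :=
  strictAnti_nat_of_succ_lt fun k => lt_of_le_not_ge (M_succ_le k) fun h => by
    obtain ⟨w, hw, g, hg⟩ := exists_word hd k
    exact hg (h (hw g))

end RegularTree

end

theorem mainTheorem2 (d : ℕ) (hd : 3 ≤ d) (hodd : Odd d) :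
    StrictAnti (RegularTree.M d) ∧
    (∀ k : ℕ, RegularTree.IsVerbal (RegularTree.M d k)) ∧
    (∀ H : Subgroup (RegularTree.autT d),
      RegularTree.IsFullyInvariant H ↔ H = ⊥ ∨ ∃ k : ℕ, H = RegularTree.M d k) ∧
    (∀ H : Subgroup (RegularTree.autT d),
      RegularTree.IsVerbal H ↔ H = ⊥ ∨ ∃ k : ℕ, H = RegularTree.M d k) := by
  have hV : ∀ H : Subgroup (RegularTree.autT d),
      (H = ⊥ ∨ ∃ k : ℕ, H = RegularTree.M d k) → RegularTree.IsVerbal H := by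
    rintro H (rfl | ⟨k, rfl⟩)
    · exact RegularTree.isVerbal_bot
    · exact RegularTree.isVerbal_M hd hodd k
  exact ⟨RegularTree.M_strictAnti hd, RegularTree.isVerbal_M hd hodd,
    fun H => ⟨fun h => h.eq_bot_or_exists_eq_M hd hodd, fun h => (hV H h).isFullyInvariant⟩,
    fun H => ⟨fun h => h.isFullyInvariant.eq_bot_or_exists_eq_M hd hodd, hV H⟩⟩
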